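/- A polynomial hypergroup associated with a sequence $(P_n)_{n\in\mathbb N}$ of polynomials, where $\deg P_n=n$, is a hypergroup on $\mathbb N=\{0,1,2,\dots\}$ with the discrete topology, the identity element $0$, the identity map as involution, and the convolution of point masses $\delta_m*\delta_n=\sum_k c(m,n,k)\,\delta_k$, a finitely supported probability measure, whose weights are determined by the linearization $$P_m P_n=\sum_k c(m,n,k)\,P_k\qquad(m,n\in\mathbb N).$$ For $h:\mathbb N\to\mathbb C$ write $h(m*n)=\sum_k c(m,n,k)\,h(k)$. A function $\varphi:\mathbb N\to\mathbb C$ is a generalized moment function if there are $N\in\mathbb N$ and functions $\varphi_0,\dots,\varphi_N:\mathbb N\to\mathbb C$ with $\varphi_0\not\equiv 0$ and $\varphi_N=\varphi$ such that $$\varphi_k(m*n)=\sum_{j=0}^{k}\binom kj\varphi_j(m)\,\varphi_{k-j}(n)\qquad(0\le k\le N,\ m,n\in\mathbb N).$$ Corollary (polynomial hypergroups). Let $X$ be a polynomial hypergroup associated with the sequence of polynomials $(P_n)_{n\in\mathbb N}$. Then every function $f:\mathbb N\to\mathbb C$ is the pointwise limit of a sequence of (finite, complex) linear combinations of generalized moment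 functions on $X$. -/

import Mathlib

/-- A commutative hypergroup on a set `X` with the discrete topology. The probability measure
`δ_x * δ_y` has compact, i.e. finite, support and is recorded by its weights:
`δ_x * δ_y = ∑ t, conv x y t • δ_t`. All topological axioms of a hypergroup are automatic for the
discrete topology. -/
structure DiscreteCommHypergroup (X : Type*) where
  /-- the convolution `δ_x * δ_y` of point masses -/
  conv : X → X → X →₀ ℝ
  /-- the identity element `o` -/
  one : X
  /-- the involution -/
  inv : X → X
  conv_nonneg : ∀ x y t, 0 ≤ conv x y t
  conv_sum : ∀ x y, ((conv x y).sum fun _ w => w) = 1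
  /-- `δ_x * (δ_y * δ_z) = (δ_x * δ_y) * δ_z` -/
  conv_assoc : ∀ x y z,
    ((conv y z).sum fun t w => w • conv x t) = (conv x y).sum fun t w => w • conv t z
  conv_comm : ∀ x y, conv x y = conv y x
  /-- `δ_o * δ_x = δ_x` -/
  one_conv : ∀ x, conv one x = Finsupp.single x 1
  inv_involutive : Function.Involutive inv
  /-- the image of `δ_x * δ_y` under the involution is the convolution of the involuted point
  masses in reversed order -/
  conv_inv : ∀ x y, (conv x y).mapDomain inv = conv (inv y) (inv x)
  /-- the identity lies in the support of `δ_x * δ_y` iff `x` is the involute of `y` -/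
  one_mem_support : ∀ x y, one ∈ (conv x y).support ↔ x = inv y

namespace DiscreteCommHypergroup

variable {X : Type*}

/-- `h(x * y) = ∫ h d(δ_x * δ_y)`. -/
noncomputable def translate (K : DiscreteCommHypergroup X) (h : X → ℂ) (x y : X) : ℂ :=
  (K.conv x y).sum fun t w => (w : ℂ) * h t

/-- `φ 0, …, φ N` form a generalized moment function sequence of order `N` on `K`. The terms
beyond `N` are irrelevant. The requirement that `φ 0` is not identically zero says that `φ 0` is an
exponential; it excludes only the sequence with all terms zero. Continuity is automatic. -/
def IsMomentSequence (K : DiscreteCommHypergroup X) (N : ℕ) (φ : ℕ → X → ℂ) : Prop :=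
  φ 0 ≠ 0 ∧ ∀ k ≤ N, ∀ x y : X, K.translate (φ k) x y =
    ∑ j ∈ Finset.range (k + 1), (k.choose j : ℂ) * φ j x * φ (k - j) y

/-- `f` is a generalized moment function (of some order `N`) on `K`. -/
def IsMomentFunction (K : DiscreteCommHypergroup X) (f : X → ℂ) : Prop :=
  ∃ (N : ℕ) (φ : ℕ → X → ℂ), K.IsMomentSequence N φ ∧ φ N = f

/-- The hypergroup `K` on `ℕ` (with identity `0` and the identity map as involution) is the
polynomial hypergroup associated with the sequence of polynomials `P`: `P n` has degree `n`, and
the weights of `δ_m * δ_n` are the coefficients of the linearization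
`P m * P n = ∑ k, c(m, n, k) P k`. -/
def IsPolynomialHypergroup (K : DiscreteCommHypergroup ℕ) (P : ℕ → Polynomial ℂ) : Prop :=
  K.one = 0 ∧ (∀ n, K.inv n = n) ∧ (∀ n, (P n).degree = (n : WithBot ℕ)) ∧
    ∀ m n, P m * P n = (K.conv m n).sum fun k w => Polynomial.C (w : ℂ) * P k

end DiscreteCommHypergroup

/-!
For a fixed `z : ℂ`, evaluating the linearization formula at `z` shows that `n ↦ (P n).eval z` is an
exponential of the polynomial hypergroup, hence a generalized moment function of order `0`
(`isMomentFunction_eval`). Exponentials alone already interpolate: since `deg P n = n`, the `P n`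
form a basis of `ℂ[X]`, so there is a linear functional `L` on `ℂ[X]` with `L (P n) = f n`. By
Lagrange interpolation at the nodes `0, 1, …, j`, every polynomial `p` of degree at most `j` is a
combination of its values at the nodes, so `L p = ∑ i ≤ j, L (ℓ i) * p.eval i` with `ℓ i` the Lagrange
basis polynomials. For `p = P n` this writes `f n`, for all `n ≤ j`, as a fixed linear combination
of exponentials (`exists_mem_span_eq_of_le`). Letting `j` grow, the approximating sequence is
eventually constant at each `n`.
-/

open Polynomial in
theorem DiscreteCommHypergroup.IsPolynomialHypergroup.isMomentFunction_eval
    {K : DiscreteCommHypergroup ℕ} {P : ℕ → ℂ[X]} (hK : K.IsPolynomialHypergroup P) (z : ℂ) :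
    K.IsMomentFunction fun n => (P n).eval z := by
  obtain ⟨-, -, hdeg, hmul⟩ := hK
  refine ⟨0, fun _ n => (P n).eval z, ⟨fun h => ?_, fun k hk m n => ?_⟩, rfl⟩
  · -- `P 0` is a nonzero constant, so it does not vanish at `z`.
    have h0 : (P 0).degree = 0 := by simpa using hdeg 0
    have hz : (P 0).eval z = 0 := congrFun h 0
    rw [eq_C_of_degree_eq_zero h0, eval_C] at hz
    rw [eq_C_of_degree_eq_zero h0, hz] at h0
    simp at h0
  · obtain rfl : k = 0 := Nat.le_zero.mp hk
    have h := congrArg (eval z) (hmul m n)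
    simp only [Finsupp.sum, eval_mul, eval_finsetSum, eval_C] at h
    simp [DiscreteCommHypergroup.translate, Finsupp.sum, h]

open Polynomial in
/-- Any function agrees on `{0, …, j}` with a linear combination of generalized moment functions. -/
theorem DiscreteCommHypergroup.IsPolynomialHypergroup.exists_mem_span_eq_of_le
    {K : DiscreteCommHypergroup ℕ} {P : ℕ → ℂ[X]} (hK : K.IsPolynomialHypergroup P)
    (f : ℕ → ℂ) (j : ℕ) :
    ∃ g ∈ Submodule.span ℂ {φ : ℕ → ℂ | K.IsMomentFunction φ}, ∀ n ≤ j, g n = f n := by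
  have hdeg := hK.2.2.1
  let S : Polynomial.Sequence ℂ := ⟨P, hdeg⟩
  let b := S.basis fun n => (leadingCoeff_ne_zero.mpr (S.ne_zero n)).isUnit
  let L : ℂ[X] →ₗ[ℂ] ℂ := b.constr ℂ f
  have hL (n : ℕ) : L (P n) = f n := by
    have hb : b n = P n := S.basis_eq_self _ n
    rw [← hb, b.constr_basis]
  let s := Finset.range (j + 1)
  let v : ℕ → ℂ := fun i => i
  refine ⟨∑ i ∈ s, L (Lagrange.basis s v i) • fun n => (P n).eval (v i),
    Submodule.sum_mem _ fun i _ => Submodule.smul_mem _ _ <|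
      Submodule.subset_span (hK.isMomentFunction_eval (v i)), fun n hn => ?_⟩
  have hlt : (P n).degree < s.card := by
    rw [hdeg, Finset.card_range]
    exact_mod_cast Nat.lt_succ_of_le hn
  have h := congrArg L (Lagrange.eq_interpolate (Nat.cast_injective.injOn : Set.InjOn v s) hlt)
  simp only [Lagrange.interpolate_apply, ← smul_eq_C_mul, map_sum, map_smul, hL, smul_eq_mul] at h
  rw [h]
  simp [v, mul_comm]

theorem mainTheorem2 (K : DiscreteCommHypergroup ℕ) (P : ℕ → Polynomial ℂ)
    (hK : K.IsPolynomialHypergroup P) (f : ℕ → ℂ) :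
    ∃ g : ℕ → ℕ → ℂ,
      (∀ j, g j ∈ Submodule.span ℂ {φ : ℕ → ℂ | K.IsMomentFunction φ}) ∧
      ∀ n, Filter.Tendsto (fun j => g j n) Filter.atTop (nhds (f n)) := by
  choose g hg hgf using hK.exists_mem_span_eq_of_le f
  exact ⟨g, hg, fun n => tendsto_atTop_of_eventually_const fun j hj => hgf j n hj⟩
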